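/- Let $k\ge 1$ be an integer and $T>0$. Write $\mathbf w^2=\sum_{j=1}^k w_j^2$ for real or complex vectors. For $t>0$ let $\mu^k_t(d\mathbf x)=(2\pi t)^{-k/2}e^{-\mathbf x^2/(2t)}\,d\mathbf x$ on $\mathbb R^k$, and let $$d\gamma^k_T(\mathbf u+i\mathbf v)=(\pi(e^T+1))^{-\frac k2}(\pi(e^T-1))^{-\frac k2}e^{-\frac{\mathbf u^2}{e^T+1}}e^{-\frac{\mathbf v^2}{e^T-1}}\,d\mathbf u\,d\mathbf v$$ on $\mathbb C^k=\mathbb R^{2k}$ (so the real and imaginary parts of each coordinate have variances $(e^T+1)/2$ and $(e^T-1)/2$). Let $\mathcal HL^2(\mathbb C^k,\gamma^k_T)$ be the space of entire holomorphic functions on $\mathbb C^k$ that are square integrable with respect to $\gamma^k_T$, with the $L^2$ inner product. For $0<t<2s$ and $f\in L^2(\mathbb R^k,\mu^k_s)$ let $$(\mathcal B^k_{s,t}f)(\mathbf z)=(2\pi t)^{-\frac k2}\int_{\mathbb R^k}f(\mathbf y)\,e^{-\frac{(\mathbf z-\mathbf y)^2}{2t}}\,d\mathbf y,\qquad \mathbf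 z\in\mathbb C^k,$$ and for an entire function $F$ and $\lambda\in\mathbb C$ let $(e^{\lambda(a\partial_a)_k}F)(\mathbf a)=F(e^\lambda\mathbf a)$. Then, for every $f\in L^2(\mathbb R^k,\mu^k_1)$, the integral defining $\mathcal B^k_{1,1-e^{-T}}f$ converges absolutely at every $\mathbf z\in\mathbb C^k$, and $\mathcal B^k_{1,1-e^{-T}}f$ is an entire function which extends the heat-operator image $e^{\frac{1-e^{-T}}2\Delta_{\mathbb R^k}}f=f*\mu^k_{1-e^{-T}}$ from $\mathbb R^k$ to $\mathbb C^k$. The map $$e^{-\frac T2(a\partial_a)_k}\,\mathcal B^k_{1,\,1-e^{-T}}$$ is a unitary map from $L^2(\mathbb R^k,\mu^k_1)$ onto $\mathcal HL^2(\mathbb C^k,\gamma^k_T)$. In particular, for every $f\in L^2(\mathbb R^k,\mu^k_1)$, $$\int_{\mathbb R^k}|f(\mathbf x)|^2\,d\mu^k_1(\mathbf x)=\int_{\mathbb C^k}\left|\left(e^{-\frac T2(a\partial_a)_k}\mathcal B^k_{1,\,1-e^{-T}}f\right)(\mathbf a)\right|^2d\gamma^k_T(\mathbf a).$$ -/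

import Mathlib

open MeasureTheory
open scoped ComplexConjugate

noncomputable section

/-- The Gaussian density `(2πt)^{-k/2} exp(-x²/(2t))` on `ℝ^k`, where `x² = ∑ x_j²`
(the space `ℝ^k` is `Fin k → ℝ` with Lebesgue measure; its norm plays no role). -/
def heatDensity (k : ℕ) (t : ℝ) (x : Fin k → ℝ) : ℝ :=
  (2 * Real.pi * t) ^ (-((k : ℝ) / 2)) * Real.exp (-(∑ j, x j ^ 2) / (2 * t))

/-- The heat kernel measure `μ_t^k` on `ℝ^k`. -/
def heatMeasure (k : ℕ) (t : ℝ) : Measure (Fin k → ℝ) :=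
  volume.withDensity fun x => ENNReal.ofReal (heatDensity k t x)

/-- The heat operator `e^{(t/2)Δ}`: convolution with the Gaussian density. -/
def heatOperator (k : ℕ) (t : ℝ) (f : (Fin k → ℝ) → ℂ) (x : Fin k → ℝ) : ℂ :=
  ∫ y, f y * (heatDensity k t (x - y) : ℂ)

/-- The integrand `f(y) exp(-(z-y)²/(2t))` of the Segal–Bargmann transform, where
`w² = ∑ w_j²` is the complex bilinear square. -/
def segalBargmannIntegrand (k : ℕ) (t : ℝ) (f : (Fin k → ℝ) → ℂ) (z : Fin k → ℂ)
    (y : Fin k → ℝ) : ℂ :=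
  f y * Complex.exp (-(∑ j, (z j - (y j : ℂ)) ^ 2) / (2 * (t : ℂ)))

/-- The two-parameter Segal–Bargmann transform `B^k_{s,t}` on `L²(ℝ^k, μ_s^k)`,
`(B f)(z) = (2πt)^{-k/2} ∫ f(y) exp(-(z-y)²/(2t)) dy`. The parameter `s` is the variance of the
Gaussian that defines the domain. -/
def segalBargmann (k : ℕ) (s t : ℝ) (f : Lp ℂ 2 (heatMeasure k s)) (z : Fin k → ℂ) : ℂ :=
  (((2 * Real.pi * t) ^ (-((k : ℝ) / 2)) : ℝ) : ℂ) * ∫ y, segalBargmannIntegrand k t f z y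

/-- The operator `e^{l (a∂_a)_k}`: `F(a) ↦ F(e^l a)`. -/
def eulerDilation (k : ℕ) (l : ℂ) (F : (Fin k → ℂ) → ℂ) (a : Fin k → ℂ) : ℂ :=
  F (Complex.exp l • a)

/-- The Gaussian measure `γ_T^k` on `ℂ^k = ℝ^{2k}`, with respect to Lebesgue measure `du dv`,
`a = u + iv`. -/
def gammaMeasure (k : ℕ) (T : ℝ) : Measure (Fin k → ℂ) :=
  volume.withDensity fun a => ENNReal.ofReal
    ((Real.pi * (Real.exp T + 1)) ^ (-((k : ℝ) / 2)) *
      (Real.pi * (Real.exp T - 1)) ^ (-((k : ℝ) / 2)) *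
      Real.exp (-(∑ j, (a j).re ^ 2) / (Real.exp T + 1)) *
      Real.exp (-(∑ j, (a j).im ^ 2) / (Real.exp T - 1)))

/-- The linear space of entire functions on `ℂ^k` that are square integrable for `m`. -/
def holoL2Submodule {k : ℕ} (m : Measure (Fin k → ℂ)) :
    Submodule ℂ ((Fin k → ℂ) → ℂ) where
  carrier := {F | Differentiable ℂ F ∧ MemLp F 2 m}
  add_mem' := fun hF hG => ⟨hF.1.add hG.1, hF.2.add hG.2⟩
  zero_mem' := ⟨differentiable_const 0, MemLp.zero⟩
  smul_mem' := fun c _ hF => ⟨hF.1.const_smul c, hF.2.const_smul c⟩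

/-- `HL²(ℂ^k, m)`, a space of actual entire functions (not of classes of functions). -/
def HoloL2 {k : ℕ} (m : Measure (Fin k → ℂ)) : Type := ↥(holoL2Submodule m)

namespace HoloL2

variable {k : ℕ} {m : Measure (Fin k → ℂ)}

instance : AddCommGroup (HoloL2 m) := inferInstanceAs (AddCommGroup ↥(holoL2Submodule m))

instance : Module ℂ (HoloL2 m) := inferInstanceAs (Module ℂ ↥(holoL2Submodule m))

instance : CoeFun (HoloL2 m) fun _ => (Fin k → ℂ) → ℂ := ⟨Subtype.val⟩

/-- The class in `L²(ℂ^k, m)` of an element of `HL²(ℂ^k, m)`. -/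
def toL2 : HoloL2 m →ₗ[ℂ] Lp ℂ 2 m where
  toFun F := MemLp.toLp F F.2.2
  map_add' _ _ := rfl
  map_smul' _ _ := rfl

/-- The norm of `HL²(ℂ^k, m)` is the `L²` norm. It is stated as a seminorm, since `m` is an
arbitrary measure here. -/
instance : SeminormedAddCommGroup (HoloL2 m) :=
  SeminormedAddCommGroup.induced (HoloL2 m) (Lp ℂ 2 m) (toL2 (m := m))

/-- The `L²` inner product, conjugate linear in the first argument. -/
instance : Inner ℂ (HoloL2 m) := ⟨fun F G => ∫ a, conj (F a) * G a ∂m⟩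

theorem inner_toL2 (F G : HoloL2 m) : inner ℂ (toL2 F) (toL2 G) = inner ℂ F G := by
  rw [L2.inner_def]
  refine integral_congr_ae ?_
  filter_upwards [MemLp.coeFn_toLp F.2.2, MemLp.coeFn_toLp G.2.2] with a hF hG
  change inner ℂ ((MemLp.toLp F F.2.2 : Lp ℂ 2 m) a) ((MemLp.toLp G G.2.2 : Lp ℂ 2 m) a) = _
  rw [hF, hG, RCLike.inner_apply, mul_comm]

instance : InnerProductSpace ℂ (HoloL2 m) where
  norm_smul_le c F := by
    change ‖toL2 (c • F)‖ ≤ ‖c‖ * ‖toL2 F‖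
    rw [map_smul, norm_smul]
  norm_sq_eq_re_inner F := by
    rw [← inner_toL2]
    exact norm_sq_eq_re_inner (𝕜 := ℂ) (toL2 F)
  conj_inner_symm F G := by
    rw [← inner_toL2, ← inner_toL2]
    exact inner_conj_symm _ _
  add_left F G H := by
    rw [← inner_toL2, ← inner_toL2, ← inner_toL2, map_add]
    exact inner_add_left _ _ _
  smul_left F G c := by
    rw [← inner_toL2, ← inner_toL2, map_smul]
    exact inner_smul_left _ _ _

end HoloL2

end

/-! Put `x = e^T`, `t = 1 - e^{-T}` and `r = e^{-T/2}`, so that `r² x = 1` and `t x = x - 1`.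

Isometry. Expanding the square in the kernel at `r(u + iv)` gives a factor of modulus `exp(r²
v²/(2t))`, independent of `y`, times the Fourier kernel `exp(i(r/t) y·v)`, times the real Gaussian
`exp(-(ru - y)²/(2t))`. For fixed `u` the transform is thus a Fourier integral in `v` of an `L¹ ∩
L²` function. Since `r²/t = 1/(x - 1)`, the growth in `v` of its squared modulus cancels the
`v`-Gaussian of `γ_T` exactly, and Plancherel applies. After Tonelli, the remaining Gaussian
integral in `u` is the density of `μ₁` at `y` (`lintegral_gamma_kernel`).

Surjectivity. The range of an isometry on a complete space is closed, so it suffices that an entire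
`F` orthogonal to the range vanishes. Explicit Gaussians are mapped to nonzero multiples of coherent
states (`exists_segalBargmann_eq_coherent`). Paired with the state at `w` and recentred there, the
integrand is an entire function times a rotation invariant Gaussian. The mean value property
(`integral_entire_mul_weight`) evaluates the pairing as a nonzero multiple of `F w`. -/

/-! ### Plancherel's theorem for Fourier integrals on `ℝ^k` -/

open scoped FourierTransform in
-- Both sides define the same distribution: against a smooth compactly supported test function, the
-- Fourier transform can be moved onto the test function, for the `L²` extension and for the
-- integral alike.
theorem MeasureTheory.MemLp.coeFn_fourier_toLp {E : Type*} [NormedAddCommGroup E]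
    [InnerProductSpace ℝ E] [FiniteDimensional ℝ E] [MeasurableSpace E] [BorelSpace E]
    {g : E → ℂ} (h1 : Integrable g) (h2 : MemLp g 2) :
    (𝓕 (h2.toLp g) : Lp ℂ 2 (volume : Measure E)) =ᵐ[volume] 𝓕 g := by
  have hcont : Continuous (𝓕 g) :=
    VectorFourier.fourierIntegral_continuous Real.continuous_fourierChar continuous_inner h1
  refine ae_eq_of_integral_contDiff_smul_eq
    ((Lp.memLp _).locallyIntegrable (by norm_num)) hcont.locallyIntegrable ?_
  intro φ hφ hφc
  have hc : HasCompactSupport (fun x => (φ x : ℂ)) := hφc.comp_left Complex.ofReal_zero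
  let ψ : SchwartzMap E ℂ := hc.toSchwartzMap (Complex.ofRealCLM.contDiff.comp hφ)
  have hψ : ∀ x, ψ x = (φ x : ℂ) := fun x => rfl
  have key := congrArg (fun D => D ψ) (Lp.fourier_toTemperedDistribution_eq (h2.toLp g))
  simp only [TemperedDistribution.fourier_apply, Lp.toTemperedDistribution_apply] at key
  have hflip := VectorFourier.integral_fourierIntegral_smul_eq_flip (L := innerₗ E)
    (f := ψ) (g := g) Real.continuous_fourierChar continuous_inner (ψ.integrable (μ := volume)) h1
  calc ∫ x, φ x • (𝓕 (h2.toLp g) : Lp ℂ 2 (volume : Measure E)) x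
      = ∫ x, ψ x • (𝓕 (h2.toLp g) : Lp ℂ 2 (volume : Measure E)) x := by
        simp [hψ]
    _ = ∫ x, (𝓕 ψ) x • (h2.toLp g) x := key.symm
    _ = ∫ x, (𝓕 (ψ : E → ℂ)) x • g x := by
        refine integral_congr_ae ?_
        filter_upwards [h2.coeFn_toLp] with x hx
        rw [hx, SchwartzMap.fourier_coe]
    _ = ∫ x, ψ x • (𝓕 g) x := by
        refine hflip.trans ?_
        rw [flip_innerₗ]
        rfl
    _ = _ := by simp [hψ]

theorem eLpNorm_two_sq {α E : Type*} [MeasurableSpace α] [NormedAddCommGroup E] (f : α → E)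
    (μ : Measure α) : eLpNorm f 2 μ ^ 2 = ∫⁻ x, ‖f x‖ₑ ^ 2 ∂μ := by
  have h := eLpNorm_nnreal_pow_eq_lintegral (f := f) (μ := μ) (p := 2) two_ne_zero
  have h2 : ((2 : NNReal) : ℝ) = ((2 : ℕ) : ℝ) := by norm_num
  simpa only [h2, ENNReal.rpow_natCast, ENNReal.coe_ofNat] using h

open scoped FourierTransform in
/-- Plancherel's theorem for `L¹ ∩ L²`. -/
theorem lintegral_enorm_fourier_sq {E : Type*} [NormedAddCommGroup E]
    [InnerProductSpace ℝ E] [FiniteDimensional ℝ E] [MeasurableSpace E] [BorelSpace E]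
    {g : E → ℂ} (h1 : Integrable g) (h2 : MemLp g 2) :
    ∫⁻ ξ, ‖𝓕 g ξ‖ₑ ^ 2 = ∫⁻ y, ‖g y‖ₑ ^ 2 := by
  have hn := congrArg ENNReal.ofReal (Lp.norm_fourier_eq (h2.toLp g))
  rw [ofReal_norm, ofReal_norm, Lp.enorm_def, Lp.enorm_def,
    eLpNorm_congr_ae (h2.coeFn_fourier_toLp h1), eLpNorm_congr_ae h2.coeFn_toLp] at hn
  rw [← eLpNorm_two_sq, ← eLpNorm_two_sq, hn]

/-- Plancherel needs an inner product space, while the transform lives on `Fin k → ℝ` with its sup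
norm; the identification with `EuclideanSpace` preserves volume. -/
theorem lintegral_enorm_fourier_pi_sq {k : ℕ} {g : (Fin k → ℝ) → ℂ} (h1 : Integrable g)
    (h2 : MemLp g 2) :
    ∫⁻ ξ : Fin k → ℝ, ‖∫ y : Fin k → ℝ,
      Complex.exp ((-2 * Real.pi * ∑ j, y j * ξ j : ℝ) * Complex.I) * g y‖ₑ ^ 2 =
      ∫⁻ y, ‖g y‖ₑ ^ 2 := by
  have hp := PiLp.volume_preserving_toLp (Fin k)
  have hq := PiLp.volume_preserving_ofLp (Fin k)
  have hme := (MeasurableEquiv.toLp 2 (Fin k → ℝ)).measurableEmbedding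
  have h1' : Integrable (fun x : EuclideanSpace ℝ (Fin k) => g x.ofLp) :=
    hq.integrable_comp_of_integrable h1
  have h2' : MemLp (fun x : EuclideanSpace ℝ (Fin k) => g x.ofLp) 2 :=
    h2.comp_measurePreserving hq
  have key := lintegral_enorm_fourier_sq h1' h2'
  rw [← hp.lintegral_comp_emb hme, ← hp.lintegral_comp_emb hme] at key
  simp only [Real.fourier_eq'] at key
  rw [← key]
  refine lintegral_congr fun ξ => ?_
  rw [← hp.integral_comp hme]
  simp [PiLp.inner_apply, mul_comm]

theorem lintegral_enorm_fourier_scaled_sq {k : ℕ} {g : (Fin k → ℝ) → ℂ} (h1 : Integrable g)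
    (h2 : MemLp g 2) {c : ℝ} (hc : c ≠ 0) :
    ∫⁻ v : Fin k → ℝ, ‖∫ y : Fin k → ℝ,
      Complex.exp ((c * ∑ j, y j * v j : ℝ) * Complex.I) * g y‖ₑ ^ 2 =
      ENNReal.ofReal ((2 * Real.pi / |c|) ^ k) * ∫⁻ y, ‖g y‖ₑ ^ 2 := by
  rw [← lintegral_enorm_fourier_pi_sq h1 h2]
  have hpi := Real.pi_pos
  -- With `ξ = s v` the kernel `exp(-2πi y·ξ)` becomes `exp(i c y·v)`; the Jacobian is `|s|^k`.
  set s : ℝ := -c / (2 * Real.pi) with hs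
  have hs0 : s ≠ 0 := div_ne_zero (neg_ne_zero.2 hc) Real.two_pi_pos.ne'
  have hsa : |s| = |c| / (2 * Real.pi) := by
    rw [hs, abs_div, abs_neg, abs_of_pos Real.two_pi_pos]
  have hsp : 0 < |s| := abs_pos.2 hs0
  have hme : MeasurableEmbedding (fun v : Fin k → ℝ => s • v) :=
    (Homeomorph.smulOfNeZero s hs0).measurableEmbedding
  have hmap := Measure.map_addHaar_smul (volume : Measure (Fin k → ℝ)) hs0
  have e1 : (volume : Measure (Fin k → ℝ)) = ENNReal.ofReal (|s| ^ k) •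
      Measure.map (fun v => s • v) volume := by
    rw [hmap, smul_smul, ← ENNReal.ofReal_mul (by positivity)]
    simp [abs_inv, abs_pow, hs0]
  have e2 : ENNReal.ofReal ((2 * Real.pi / |c|) ^ k) * ENNReal.ofReal (|s| ^ k) = 1 := by
    have hca : |c| ≠ 0 := abs_ne_zero.2 hc
    have : 2 * Real.pi / |c| * (|c| / (2 * Real.pi)) = 1 := by field_simp
    rw [← ENNReal.ofReal_mul (by positivity), ← mul_pow, hsa, this]
    simp
  have e3 : ∀ F : (Fin k → ℝ) → ENNReal,
      ENNReal.ofReal ((2 * Real.pi / |c|) ^ k) * ∫⁻ v, F v = ∫⁻ v, F (s • v) := fun F => by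
    conv_lhs => rw [e1]
    rw [lintegral_smul_measure, hme.lintegral_map, smul_eq_mul, ← mul_assoc, e2, one_mul]
  rw [e3]
  refine lintegral_congr fun v => ?_
  have : ∀ y : Fin k → ℝ, -2 * Real.pi * ∑ j, y j * (s • v) j = c * ∑ j, y j * v j := by
    intro y
    simp only [Pi.smul_apply, smul_eq_mul, Finset.mul_sum]
    refine Finset.sum_congr rfl fun j _ => ?_
    rw [hs]; field_simp
  simp only [this]

/-! ### Mean value property in several complex variables -/

theorem measurePreserving_circle_smul_pi {k : ℕ} (c : Circle) :
    MeasurePreserving (fun b : Fin k → ℂ => (c : ℂ) • b) volume volume :=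
  volume_preserving_pi fun _ => (rotation c).measurePreserving

/-- Mean value property of entire functions for weights invariant under rotations. -/
theorem integral_entire_mul_weight {k : ℕ} {H : (Fin k → ℂ) → ℂ} (hH : Differentiable ℂ H)
    {ρ : (Fin k → ℂ) → ℂ} (hρ : Continuous ρ) (hrot : ∀ (c : Circle) b, ρ ((c : ℂ) • b) = ρ b)
    (hint : Integrable (fun b => H b * ρ b)) :
    ∫ b, H b * ρ b = H 0 * ∫ b, ρ b := by
  have hemb : ∀ c : Circle, MeasurableEmbedding (fun b : Fin k → ℂ => (c : ℂ) • b) := fun c =>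
    (Homeomorph.smulOfNeZero (c : ℂ) (Circle.coe_ne_zero c)).measurableEmbedding
  have hinv : ∀ θ : ℝ, ∫ b, H ((Circle.exp θ : ℂ) • b) * ρ b = ∫ b, H b * ρ b := fun θ => by
    rw [← (measurePreserving_circle_smul_pi (Circle.exp θ)).integral_comp (hemb _)
      (fun b => H b * ρ b)]
    simp only [hrot]
  have hinvn : ∀ θ : ℝ, ∫ b, ‖H ((Circle.exp θ : ℂ) • b) * ρ b‖ = ∫ b, ‖H b * ρ b‖ := fun θ => by
    rw [← (measurePreserving_circle_smul_pi (Circle.exp θ)).integral_comp (hemb _)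
      (fun b => ‖H b * ρ b‖)]
    simp only [hrot]
  have hprod : Integrable (Function.uncurry fun (θ : ℝ) (b : Fin k → ℂ) =>
      H ((Circle.exp θ : ℂ) • b) * ρ b)
      ((volume.restrict (Set.uIoc 0 (2 * Real.pi))).prod volume) := by
    have hc : Continuous (Function.uncurry fun (θ : ℝ) (b : Fin k → ℂ) =>
      H ((Circle.exp θ : ℂ) • b) * ρ b) := by
      have := hH.continuous
      have h3 : Continuous fun p : ℝ × (Fin k → ℂ) => (Circle.exp p.1 : ℂ) • p.2 := by fun_prop
      exact (this.comp h3).mul (hρ.comp continuous_snd)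
    rw [integrable_prod_iff hc.aestronglyMeasurable]
    refine ⟨Filter.Eventually.of_forall fun θ => ?_, ?_⟩
    · have := (measurePreserving_circle_smul_pi (k := k) (Circle.exp θ)).integrable_comp_of_integrable
        hint
      simpa only [Function.comp_def, Function.uncurry, hrot] using this
    -- The `L¹` norm of each rotated integrand is the same constant, and the angle runs over a
    -- bounded interval.
    · simp only [Function.uncurry, hinvn]
      exact (integrable_const_iff.2 (Or.inr ⟨by simp [Set.uIoc]⟩))
  have hswap := intervalIntegral_integral_swap (a := 0) (b := 2 * Real.pi) hprod
  simp only [hinv] at hswap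
  -- For fixed `b` this is the one-variable mean value property of `ζ ↦ H (ζ • b)` on the unit
  -- circle.
  have hmv : ∀ b : Fin k → ℂ, ∫ θ in (0 : ℝ)..(2 * Real.pi), H ((Circle.exp θ : ℂ) • b) * ρ b =
      (2 * Real.pi : ℂ) * (H 0 * ρ b) := fun b => by
    have hd : Differentiable ℂ (fun ζ : ℂ => H (ζ • b)) := by fun_prop
    have h := (hd.diffContOnCl (s := Metric.ball 0 |1|)).circleAverage
    simp only [Real.circleAverage, circleMap, zero_smul, Complex.ofReal_one, one_mul, zero_add] at h
    rw [intervalIntegral.integral_mul_const]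
    simp only [Circle.coe_exp]
    have hpi : (2 * Real.pi : ℂ) ≠ 0 := by exact_mod_cast Real.two_pi_pos.ne'
    rw [Complex.real_smul, inv_eq_one_div] at h
    push_cast at h
    field_simp at h
    rw [h]; ring
  simp only [hmv, intervalIntegral.integral_const, sub_zero, Complex.real_smul] at hswap
  rw [integral_const_mul, integral_const_mul] at hswap
  have hpi : (2 * Real.pi : ℂ) ≠ 0 := by exact_mod_cast Real.two_pi_pos.ne'
  push_cast at hswap
  exact mul_left_cancel₀ hpi hswap

/-! ### Gaussian measures on `ℝ^k` and bounds for the kernel -/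

theorem continuous_heatDensity (k : ℕ) (s : ℝ) : Continuous (heatDensity k s) := by
  unfold heatDensity; fun_prop

theorem heatDensity_pos (k : ℕ) {s : ℝ} (hs : 0 < s) (x : Fin k → ℝ) : 0 < heatDensity k s x := by
  unfold heatDensity
  have := Real.pi_pos
  positivity

theorem measurable_ofReal_heatDensity (k : ℕ) (s : ℝ) :
    Measurable fun x => ENNReal.ofReal (heatDensity k s x) :=
  (continuous_heatDensity k s).measurable.ennreal_ofReal

/-- Positivity of the density lets statements that hold almost everywhere for the Gaussian be used
under Lebesgue integrals. -/
theorem volume_absolutelyContinuous_heatMeasure (k : ℕ) {s : ℝ} (hs : 0 < s) :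
    (volume : Measure (Fin k → ℝ)) ≪ heatMeasure k s :=
  withDensity_absolutelyContinuous' (measurable_ofReal_heatDensity k s).aemeasurable
    (Filter.Eventually.of_forall fun x => by simpa using heatDensity_pos k hs x)

theorem integrable_exp_neg_sum_sq (k : ℕ) {c : ℝ} (hc : 0 < c) (b : Fin k → ℝ) :
    Integrable fun y : Fin k → ℝ => Real.exp (-c * ∑ j, y j ^ 2 + ∑ j, b j * y j) := by
  have h := (GaussianFourier.integrable_cexp_neg_mul_sum_add (ι := Fin k) (b := (c : ℂ))
    (by simpa) (fun j => (b j : ℂ))).norm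
  refine h.congr (Filter.Eventually.of_forall fun y => ?_)
  simp only [Complex.norm_exp]
  congr 1
  rw [← Complex.ofReal_re (-c * ∑ j, y j ^ 2 + ∑ j, b j * y j)]
  push_cast
  rfl

theorem isFiniteMeasure_heatMeasure (k : ℕ) {s : ℝ} (hs : 0 < s) :
    IsFiniteMeasure (heatMeasure k s) := by
  refine isFiniteMeasure_withDensity_ofReal ?_
  have h := (integrable_exp_neg_sum_sq k (c := 1 / (2 * s)) (by positivity) 0).const_mul
    ((2 * Real.pi * s) ^ (-((k : ℝ) / 2)))
  refine Integrable.hasFiniteIntegral (h.congr (Filter.Eventually.of_forall fun y => ?_))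
  simp only [heatDensity, Pi.zero_apply, zero_mul, Finset.sum_const_zero, add_zero]
  congr 2
  ring

theorem Integrable.mul_exp_of_heatMeasure {k : ℕ} {h : (Fin k → ℝ) → ℝ}
    (hh : Integrable h (heatMeasure k 1)) :
    Integrable fun y => h y * Real.exp (-(∑ j, y j ^ 2) / 2) := by
  have h2 := (integrable_withDensity_iff_integrable_smul' (measurable_ofReal_heatDensity k 1)
    (by simp)).1 hh
  have hpi := Real.pi_pos
  refine (h2.const_mul ((2 * Real.pi * 1) ^ ((k : ℝ) / 2))).congr
    (Filter.Eventually.of_forall fun y => ?_)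
  simp only [ENNReal.toReal_ofReal (heatDensity_pos k one_pos y).le, smul_eq_mul]
  rw [heatDensity, Real.rpow_neg (by positivity)]
  field_simp

/-- Elements of `L²(μ₁)` are integrable against the Gaussian of variance one. -/
theorem integrable_norm_mul_exp {k : ℕ} (f : Lp ℂ 2 (heatMeasure k 1)) :
    Integrable fun y => ‖f y‖ * Real.exp (-(∑ j, y j ^ 2) / 2) := by
  have := isFiniteMeasure_heatMeasure k one_pos
  exact Integrable.mul_exp_of_heatMeasure
    ((Lp.memLp f).integrable (q := 2) (by norm_num)).norm

theorem aestronglyMeasurable_coe_heatLp {k : ℕ} (f : Lp ℂ 2 (heatMeasure k 1)) :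
    AEStronglyMeasurable f volume :=
  (Lp.aestronglyMeasurable f).mono_ac (volume_absolutelyContinuous_heatMeasure k one_pos)

/-- Since `t < 1`, the kernel decays faster than `exp(-y²/2)`. The spare `(1 - t) y²/(2t)` absorbs
the terms linear in `|y|`, of total slope at most `(R + t)/t`. -/
theorem gaussian_exponent_le {t : ℝ} (ht0 : 0 < t) (ht1 : t < 1) {R x v : ℝ}
    (hx : |x| ≤ R) (hv : |v| ≤ R) (y : ℝ) :
    -((x - y) ^ 2 - v ^ 2) / (2 * t) + |y| ≤
      R ^ 2 / (2 * t) + (R + t) ^ 2 / (2 * t * (1 - t)) - y ^ 2 / 2 := by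
  have h1 : 0 < 1 - t := by linarith
  have hR : 0 ≤ R := (abs_nonneg x).trans hx
  have hv2 : v ^ 2 ≤ R ^ 2 := sq_le_sq' (by linarith [neg_abs_le v]) (by linarith [le_abs_self v])
  have hxy : x * y ≤ R * |y| := by
    calc x * y ≤ |x * y| := le_abs_self _
      _ = |x| * |y| := abs_mul _ _
      _ ≤ _ := by gcongr
  -- Completing the square; the maximum of the difference yields the constant `(R + t)²/(2t(1 -
  -- t))`.
  have key : 2 * (R + t) * |y| ≤ (R + t) ^ 2 / (1 - t) + (1 - t) * |y| ^ 2 := by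
    have h2 : (R + t) ^ 2 / (1 - t) + (1 - t) * |y| ^ 2 - 2 * (R + t) * |y| =
        ((R + t) - (1 - t) * |y|) ^ 2 / (1 - t) := by field_simp; ring
    have : 0 ≤ ((R + t) - (1 - t) * |y|) ^ 2 / (1 - t) := by positivity
    linarith
  rw [sq_abs] at key
  have e : R ^ 2 / (2 * t) + (R + t) ^ 2 / (2 * t * (1 - t)) - y ^ 2 / 2 -
      (-((x - y) ^ 2 - v ^ 2) / (2 * t) + |y|) =
      (R ^ 2 + (R + t) ^ 2 / (1 - t) - t * y ^ 2 + (x - y) ^ 2 - v ^ 2 - 2 * t * |y|) / (2 * t) := by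
    field_simp; ring
  have : 0 ≤ (R ^ 2 + (R + t) ^ 2 / (1 - t) - t * y ^ 2 + (x - y) ^ 2 - v ^ 2 - 2 * t * |y|) /
      (2 * t) := by
    refine div_nonneg ?_ (by positivity)
    nlinarith [sq_nonneg x]
  linarith

theorem re_heatExponent {k : ℕ} (t : ℝ) (z : Fin k → ℂ) (y : Fin k → ℝ) :
    (-(∑ j, (z j - (y j : ℂ)) ^ 2) / (2 * (t : ℂ))).re =
      ∑ j, -(((z j).re - y j) ^ 2 - (z j).im ^ 2) / (2 * t) := by
  have : (2 * (t : ℂ)) = ((2 * t : ℝ) : ℂ) := by push_cast; ring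
  rw [this, Complex.div_ofReal_re, Complex.neg_re, Complex.re_sum, ← Finset.sum_neg_distrib,
    Finset.sum_div]
  refine Finset.sum_congr rfl fun j _ => ?_
  simp [pow_two]

/-- On bounded sets of `z` the kernel, even with an exponential weight, is bounded by the
Gaussian of variance one. -/
theorem exists_norm_kernel_le {k : ℕ} {t : ℝ} (ht0 : 0 < t) (ht1 : t < 1) (R : ℝ) :
    ∃ C : ℝ, ∀ z : Fin k → ℂ, ‖z‖ ≤ R → ∀ y : Fin k → ℝ,
      ‖Complex.exp (-(∑ j, (z j - (y j : ℂ)) ^ 2) / (2 * (t : ℂ)))‖ * Real.exp (∑ j, |y j|) ≤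
        C * Real.exp (-(∑ j, y j ^ 2) / 2) := by
  refine ⟨Real.exp (k * (R ^ 2 / (2 * t) + (R + t) ^ 2 / (2 * t * (1 - t)))), fun z hz y => ?_⟩
  rw [Complex.norm_exp, re_heatExponent, ← Real.exp_add, ← Real.exp_add, ← Finset.sum_add_distrib]
  refine Real.exp_le_exp.2 ?_
  have := Finset.sum_le_sum fun (j : Fin k) (_ : j ∈ Finset.univ) =>
    gaussian_exponent_le ht0 ht1 (((z j).abs_re_le_norm).trans ((norm_le_pi_norm z j).trans hz))
      (((z j).abs_im_le_norm).trans ((norm_le_pi_norm z j).trans hz)) (y j)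
  refine this.trans_eq ?_
  rw [Finset.sum_sub_distrib, ← Finset.sum_div]
  simp
  ring

/-! ### Absolute convergence and holomorphy of the transform -/

theorem aestronglyMeasurable_segalBargmannIntegrand {k : ℕ} (t : ℝ)
    (f : Lp ℂ 2 (heatMeasure k 1)) (z : Fin k → ℂ) :
    AEStronglyMeasurable (segalBargmannIntegrand k t f z) volume := by
  refine (aestronglyMeasurable_coe_heatLp f).mul (Continuous.aestronglyMeasurable ?_)
  fun_prop

theorem integrable_segalBargmannIntegrand {k : ℕ} {t : ℝ} (ht0 : 0 < t) (ht1 : t < 1)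
    (f : Lp ℂ 2 (heatMeasure k 1)) (z : Fin k → ℂ) :
    Integrable (segalBargmannIntegrand k t f z) volume := by
  obtain ⟨C, hC⟩ := exists_norm_kernel_le (k := k) ht0 ht1 ‖z‖
  refine ((integrable_norm_mul_exp f).const_mul C).mono'
    (aestronglyMeasurable_segalBargmannIntegrand t f z) (Filter.Eventually.of_forall fun y => ?_)
  have h1 : (1 : ℝ) ≤ Real.exp (∑ j, |y j|) :=
    Real.one_le_exp (Finset.sum_nonneg fun j _ => abs_nonneg _)
  have h2 := (le_mul_of_one_le_right (norm_nonneg _) h1).trans (hC z le_rfl y)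
  rw [segalBargmannIntegrand, norm_mul]
  calc _ ≤ ‖f y‖ * (C * Real.exp (-(∑ j, y j ^ 2) / 2)) := by gcongr
    _ = _ := by ring

/-- Needed for Plancherel. The squared kernel bound has two factors `exp(-y²/2)`: one is bounded by
1, the other serves as the weight of `μ₁`. -/
theorem memLp_segalBargmannIntegrand {k : ℕ} {t : ℝ} (ht0 : 0 < t) (ht1 : t < 1)
    (f : Lp ℂ 2 (heatMeasure k 1)) (z : Fin k → ℂ) :
    MemLp (segalBargmannIntegrand k t f z) 2 volume := by
  obtain ⟨C, hC⟩ := exists_norm_kernel_le (k := k) ht0 ht1 ‖z‖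
  rw [memLp_two_iff_integrable_sq_norm (aestronglyMeasurable_segalBargmannIntegrand t f z)]
  have hf : Integrable (fun y => ‖f y‖ ^ 2) (heatMeasure k 1) :=
    (memLp_two_iff_integrable_sq_norm (Lp.aestronglyMeasurable f)).1 (Lp.memLp f)
  refine ((Integrable.mul_exp_of_heatMeasure hf).const_mul (C ^ 2)).mono'
    ((aestronglyMeasurable_segalBargmannIntegrand t f z).norm.pow 2)
    (Filter.Eventually.of_forall fun y => ?_)
  have h1 : (1 : ℝ) ≤ Real.exp (∑ j, |y j|) :=
    Real.one_le_exp (Finset.sum_nonneg fun j _ => abs_nonneg _)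
  have h2 := (le_mul_of_one_le_right (norm_nonneg _) h1).trans (hC z le_rfl y)
  have h3 : Real.exp (-(∑ j, y j ^ 2) / 2) ≤ 1 := Real.exp_le_one_iff.2
    (by have : 0 ≤ ∑ j, y j ^ 2 := Finset.sum_nonneg fun j _ => sq_nonneg _
        linarith)
  rw [segalBargmannIntegrand, norm_mul, mul_pow, norm_mul, norm_pow, norm_pow, norm_norm,
    norm_norm]
  calc _ ≤ ‖f y‖ ^ 2 * (C * Real.exp (-(∑ j, y j ^ 2) / 2)) ^ 2 := by gcongr
    _ = C ^ 2 * (‖f y‖ ^ 2 * (Real.exp (-(∑ j, y j ^ 2) / 2) *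
        Real.exp (-(∑ j, y j ^ 2) / 2))) := by ring
    _ ≤ _ := by gcongr; exact mul_le_of_le_one_left (Real.exp_nonneg _) h3

/-- The complex derivative of the integrand of the Segal-Bargmann transform. -/
noncomputable def segalBargmannIntegrandDeriv (k : ℕ) (t : ℝ) (f : (Fin k → ℝ) → ℂ)
    (z : Fin k → ℂ) (y : Fin k → ℝ) : (Fin k → ℂ) →L[ℂ] ℂ :=
  segalBargmannIntegrand k t f z y •
    ∑ j, (-(z j - (y j : ℂ)) / t) • (ContinuousLinearMap.proj j : (Fin k → ℂ) →L[ℂ] ℂ)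

theorem hasFDerivAt_segalBargmannIntegrand {k : ℕ} {t : ℝ} (f : (Fin k → ℝ) → ℂ)
    (z : Fin k → ℂ) (y : Fin k → ℝ) :
    HasFDerivAt (fun z => segalBargmannIntegrand k t f z y)
      (segalBargmannIntegrandDeriv k t f z y) z := by
  have h1 : ∀ j : Fin k, HasFDerivAt (fun z : Fin k → ℂ => (z j - (y j : ℂ)) ^ 2)
      ((2 * (z j - (y j : ℂ))) • (ContinuousLinearMap.proj j : (Fin k → ℂ) →L[ℂ] ℂ)) z := fun j => by
    have := ((hasFDerivAt_apply (𝕜 := ℂ) j z).sub_const (y j : ℂ)).pow 2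
    simpa using this
  have h2 := (((HasFDerivAt.fun_sum fun j (_ : j ∈ Finset.univ) => h1 j).fun_neg).mul_const
    ((2 * (t : ℂ))⁻¹)).cexp.const_mul (f y)
  simp only [← div_eq_mul_inv] at h2
  refine h2.congr_fderiv ?_
  rw [segalBargmannIntegrandDeriv, segalBargmannIntegrand, mul_smul]
  congr 2
  rw [← Finset.sum_neg_distrib, Finset.smul_sum]
  refine Finset.sum_congr rfl fun j _ => ?_
  rw [← neg_smul, smul_smul]
  congr 1
  field_simp

/-- Differentiation costs a factor that grows linearly in `y`; an exponential dominates it, which is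
why the kernel bound carries the weight `exp(∑ |y_j|)`. -/
theorem norm_segalBargmannIntegrandDeriv_le {k : ℕ} {t : ℝ} (ht0 : 0 < t)
    (f : (Fin k → ℝ) → ℂ) (z : Fin k → ℂ) (y : Fin k → ℝ) {R : ℝ} (hz : ‖z‖ ≤ R) :
    ‖segalBargmannIntegrandDeriv k t f z y‖ ≤
      ‖segalBargmannIntegrand k t f z y‖ * (Real.exp (k * R) / t * Real.exp (∑ j, |y j|)) := by
  rw [segalBargmannIntegrandDeriv, norm_smul]
  refine mul_le_mul_of_nonneg_left ?_ (norm_nonneg _)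
  have h1 : ∀ j : Fin k, ‖(-(z j - (y j : ℂ)) / t) •
      (ContinuousLinearMap.proj j : (Fin k → ℂ) →L[ℂ] ℂ)‖ ≤ (R + |y j|) / t := fun j => by
    have hp : ‖(ContinuousLinearMap.proj j : (Fin k → ℂ) →L[ℂ] ℂ)‖ ≤ 1 :=
      ContinuousLinearMap.opNorm_le_bound _ zero_le_one fun w => by
        simpa using norm_le_pi_norm w j
    rw [norm_smul, norm_div, norm_neg, Complex.norm_real, Real.norm_of_nonneg ht0.le]
    refine (mul_le_of_le_one_right (by positivity) hp).trans ?_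
    gcongr
    refine (norm_sub_le _ _).trans ?_
    rw [Complex.norm_real, Real.norm_eq_abs]
    gcongr
    exact (norm_le_pi_norm z j).trans hz
  refine (norm_sum_le_of_le _ fun j _ => h1 j).trans ?_
  rw [← Finset.sum_div, Finset.sum_add_distrib]
  simp only [Finset.sum_const, Finset.card_univ, Fintype.card_fin, nsmul_eq_mul]
  rw [div_mul_eq_mul_div, ← Real.exp_add]
  gcongr
  linarith [Real.add_one_le_exp (k * R + ∑ j, |y j|)]

/-- Differentiation under the integral sign, the kernel bound being uniform over the unit ball about
the point. -/
theorem differentiable_segalBargmann {k : ℕ} {t : ℝ} (ht0 : 0 < t) (ht1 : t < 1)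
    (f : Lp ℂ 2 (heatMeasure k 1)) : Differentiable ℂ (segalBargmann k 1 t f) := by
  intro z₀
  obtain ⟨C, hC⟩ := exists_norm_kernel_le (k := k) ht0 ht1 (‖z₀‖ + 1)
  refine DifferentiableAt.const_mul ?_ _
  refine (hasFDerivAt_integral_of_dominated_of_fderiv_le (s := Metric.ball z₀ 1)
    (F' := segalBargmannIntegrandDeriv k t f)
    (bound := fun y => Real.exp (k * (‖z₀‖ + 1)) / t * C *
      (‖f y‖ * Real.exp (-(∑ j, y j ^ 2) / 2)))
    (Metric.ball_mem_nhds _ one_pos)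
    (Filter.Eventually.of_forall fun z => aestronglyMeasurable_segalBargmannIntegrand t f z)
    (integrable_segalBargmannIntegrand ht0 ht1 f z₀) ?_ ?_
    ((integrable_norm_mul_exp f).const_mul _) ?_).differentiableAt
  · refine (aestronglyMeasurable_segalBargmannIntegrand t f z₀).smul
      (Continuous.aestronglyMeasurable ?_)
    fun_prop
  · refine Filter.Eventually.of_forall fun y z hz => ?_
    have hz' : ‖z‖ ≤ ‖z₀‖ + 1 := by
      have := norm_sub_norm_le z z₀
      rw [mem_ball_iff_norm] at hz
      linarith
    refine (norm_segalBargmannIntegrandDeriv_le ht0 f z y hz').trans ?_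
    rw [segalBargmannIntegrand, norm_mul]
    have := mul_le_mul_of_nonneg_left (hC z hz' y)
      (show 0 ≤ ‖f y‖ * (Real.exp (k * (‖z₀‖ + 1)) / t) by positivity)
    linarith
  · exact Filter.Eventually.of_forall fun y z _ => hasFDerivAt_segalBargmannIntegrand f z y

theorem segalBargmann_ofReal {k : ℕ} (t : ℝ) (f : Lp ℂ 2 (heatMeasure k 1)) (x : Fin k → ℝ) :
    segalBargmann k 1 t f (fun j => (x j : ℂ)) = heatOperator k t f x := by
  rw [segalBargmann, heatOperator, ← integral_const_mul]
  refine integral_congr_ae (Filter.Eventually.of_forall fun y => ?_)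
  simp only [segalBargmannIntegrand, heatDensity, Pi.sub_apply]
  push_cast
  ring

/-! ### The isometry: Plancherel in `v`, Gaussian integral in `u` -/

theorem lintegral_pi_complex {k : ℕ} {F : (Fin k → ℂ) → ENNReal} (hF : Measurable F) :
    ∫⁻ a, F a = ∫⁻ u : Fin k → ℝ, ∫⁻ v : Fin k → ℝ,
      F (fun j => (u j : ℂ) + (v j : ℂ) * Complex.I) := by
  have h1 := volume_preserving_pi (fun _ : Fin k => Complex.volume_preserving_equiv_real_prod.symm)
  have h2 := (volume_measurePreserving_arrowProdEquivProdArrow ℝ ℝ (Fin k)).symm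
  have h3 := h1.comp h2
  rw [← h3.lintegral_comp hF, Measure.volume_eq_prod, lintegral_prod _ (by
    exact (hF.comp h3.measurable).aemeasurable)]
  refine lintegral_congr fun u => lintegral_congr fun v => congrArg F (funext fun j => ?_)
  exact Complex.mk_eq_add_mul_I _ _

theorem integral_exp_neg_mul_sum_add {k : ℕ} {b : ℝ} (hb : 0 < b) (c : Fin k → ℝ) :
    ∫ v : Fin k → ℝ, Real.exp (-b * ∑ j, v j ^ 2 + ∑ j, c j * v j) =
      (Real.pi / b) ^ ((k : ℝ) / 2) * Real.exp ((∑ j, c j ^ 2) / (4 * b)) := by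
  have h := GaussianFourier.integral_cexp_neg_mul_sum_add (ι := Fin k) (b := (b : ℂ))
    (by simpa) (fun j => (c j : ℂ))
  have hpi := Real.pi_pos
  rw [← Complex.ofReal_inj, ← integral_complex_ofReal]
  push_cast [Complex.ofReal_cpow (show 0 ≤ Real.pi / b by positivity)]
  simpa using h

theorem gamma_exponent_eq {k : ℕ} {x r t : ℝ} (hx : 1 < x) (hrx : r ^ 2 * x = 1)
    (htx : t * x = x - 1) (u y : Fin k → ℝ) :
    -(∑ j, u j ^ 2) / (x + 1) + -(∑ j, (r * u j - y j) ^ 2) / t =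
      (-(2 * x / (x ^ 2 - 1)) * ∑ j, u j ^ 2 + ∑ j, (2 * r / t * y j) * u j) -
        (∑ j, y j ^ 2) / t := by
  have hx0 : x ≠ 0 := by linarith
  have h1 : x - 1 ≠ 0 := by linarith
  have h2 : x + 1 ≠ 0 := by linarith
  have h3 : x ^ 2 - 1 ≠ 0 := by rw [show x ^ 2 - 1 = (x - 1) * (x + 1) by ring]; positivity
  have ht : t = (x - 1) / x := by field_simp; linarith
  have hr : r ^ 2 = 1 / x := by field_simp; linarith
  have ht0 : t ≠ 0 := by rw [ht]; positivity
  simp only [Finset.mul_sum, ← Finset.sum_neg_distrib, Finset.sum_div, ← Finset.sum_add_distrib,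
    ← Finset.sum_sub_distrib]
  refine Finset.sum_congr rfl fun j _ => ?_
  have : -(r * u j - y j) ^ 2 / t = -(r ^ 2 / t) * u j ^ 2 + (2 * r / t * y j) * u j - y j ^ 2 / t := by
    field_simp; ring
  rw [this, hr, show 1 / x / t = 1 / (x - 1) by rw [ht]; field_simp]
  have : 2 * x / (x ^ 2 - 1) = 1 / (x + 1) + 1 / (x - 1) := by
    rw [show x ^ 2 - 1 = (x - 1) * (x + 1) by ring]; field_simp; ring
  rw [this]
  ring

theorem gamma_normalization (k : ℕ) {x r t : ℝ} (hx : 1 < x) (hr0 : 0 < r) (hrx : r ^ 2 * x = 1)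
    (htx : t * x = x - 1) :
    (Real.pi * (x + 1)) ^ (-((k : ℝ) / 2)) * (Real.pi * (x - 1)) ^ (-((k : ℝ) / 2)) *
      ((2 * Real.pi * t) ^ (-((k : ℝ) / 2))) ^ 2 * (2 * Real.pi / (r / t)) ^ k *
      (Real.pi / (2 * x / (x ^ 2 - 1))) ^ ((k : ℝ) / 2) =
      (2 * Real.pi * 1) ^ (-((k : ℝ) / 2)) := by
  have hpi := Real.pi_pos
  have h1 : 0 < x - 1 := by linarith
  have h3 : 0 < x ^ 2 - 1 := by nlinarith
  have hx0 : 0 < x := by linarith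
  have ht : t = (x - 1) / x := by field_simp; linarith
  have ht0 : 0 < t := by rw [ht]; positivity
  have hk : (2 * Real.pi / (r / t)) ^ k = ((2 * Real.pi / (r / t)) ^ 2) ^ ((k : ℝ) / 2) := by
    rw [← Real.rpow_natCast, ← Real.rpow_natCast (n := 2), ← Real.rpow_mul (by positivity)]
    congr 1
    push_cast; ring
  have hsq : ((2 * Real.pi * t) ^ (-((k : ℝ) / 2))) ^ 2 =
      ((2 * Real.pi * t) ^ 2) ^ (-((k : ℝ) / 2)) := by
    rw [← Real.rpow_natCast, ← Real.rpow_natCast (n := 2), ← Real.rpow_mul (by positivity),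
      ← Real.rpow_mul (by positivity), mul_comm (-((k : ℝ) / 2))]
  -- Every factor is now a positive base to the power `±k/2`, so the claim reduces to a rational
  -- identity between the bases.
  rw [hk, hsq]
  simp only [Real.rpow_neg_eq_inv_rpow]
  rw [← Real.mul_rpow (by positivity) (by positivity), ← Real.mul_rpow (by positivity) (by positivity),
    ← Real.mul_rpow (by positivity) (by positivity), ← Real.mul_rpow (by positivity) (by positivity)]
  congr 1
  have hr : r ^ 2 = 1 / x := by field_simp; linarith
  rw [div_pow, div_pow, hr, show x ^ 2 - 1 = (x - 1) * (x + 1) by ring]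
  field_simp

/-- The Gaussian averages in `u` of the squared kernels add up to the density of `μ₁`. -/
theorem lintegral_gamma_kernel (k : ℕ) {x r t : ℝ} (hx : 1 < x) (hr0 : 0 < r)
    (hrx : r ^ 2 * x = 1) (htx : t * x = x - 1) (y : Fin k → ℝ) :
    ∫⁻ u : Fin k → ℝ, ENNReal.ofReal ((Real.pi * (x + 1)) ^ (-((k : ℝ) / 2)) *
      (Real.pi * (x - 1)) ^ (-((k : ℝ) / 2)) *
      ((2 * Real.pi * t) ^ (-((k : ℝ) / 2))) ^ 2 * (2 * Real.pi / (r / t)) ^ k *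
      (Real.exp (-(∑ j, u j ^ 2) / (x + 1)) * Real.exp (-(∑ j, (r * u j - y j) ^ 2) / t))) =
      ENNReal.ofReal (heatDensity k 1 y) := by
  have hpi := Real.pi_pos
  have h1 : 0 < x - 1 := by linarith
  have h3 : 0 < x ^ 2 - 1 := by nlinarith
  have hx0 : 0 < x := by linarith
  have ht : t = (x - 1) / x := by field_simp; linarith
  have ht0 : 0 < t := by rw [ht]; positivity
  have hb : 0 < 2 * x / (x ^ 2 - 1) := by positivity
  simp only [← Real.exp_add, gamma_exponent_eq hx hrx htx, Real.exp_sub]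
  rw [← ofReal_integral_eq_lintegral_ofReal
    (((integrable_exp_neg_sum_sq k hb _).div_const _).const_mul _)
    (Filter.Eventually.of_forall fun u => by positivity), integral_const_mul, integral_div,
    integral_exp_neg_mul_sum_add hb, mul_div_assoc (_ ^ _),
    ← mul_assoc (_ * (2 * Real.pi / (r / t)) ^ k),
    gamma_normalization k hx hr0 hrx htx, heatDensity, ← Real.exp_sub]
  congr 3
  simp only [mul_pow, ← Finset.mul_sum]
  have hr : r ^ 2 = 1 / x := by field_simp; linarith
  rw [div_pow, mul_pow, hr, ht, show x ^ 2 - 1 = (x - 1) * (x + 1) by ring]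
  field_simp
  ring

/-- Expanding `(ru + irv - y)²` separates a factor without `y` from a Fourier kernel in `(y, v)`
applied to the integrand at the real point `ru`. -/
theorem segalBargmannIntegrand_add_mul_I {k : ℕ} {t : ℝ} (ht0 : t ≠ 0) (f : (Fin k → ℝ) → ℂ)
    (r : ℝ) (u v y : Fin k → ℝ) :
    segalBargmannIntegrand k t f ((r : ℂ) • fun j => (u j : ℂ) + (v j : ℂ) * Complex.I) y =
      Complex.exp ((r ^ 2 * (∑ j, v j ^ 2) / (2 * t) : ℝ) +
        (-(r ^ 2 / t) * ∑ j, u j * v j : ℝ) * Complex.I) *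
      (Complex.exp ((r / t * ∑ j, y j * v j : ℝ) * Complex.I) *
        segalBargmannIntegrand k t f (fun j => ((r * u j : ℝ) : ℂ)) y) := by
  have ht : (t : ℂ) ≠ 0 := by exact_mod_cast ht0
  simp only [segalBargmannIntegrand]
  rw [mul_left_comm (Complex.exp _) (f y), mul_left_comm (Complex.exp _) (f y), ← Complex.exp_add,
    ← Complex.exp_add]
  congr 2
  push_cast
  simp only [Pi.smul_apply, smul_eq_mul, Finset.mul_sum, Finset.sum_mul, Finset.sum_div,
    ← Finset.sum_neg_distrib, ← Finset.sum_add_distrib]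
  refine Finset.sum_congr rfl fun j _ => ?_
  field_simp
  linear_combination (-(r * v j : ℂ) ^ 2) * Complex.I_sq

theorem enorm_segalBargmann_add_mul_I_sq {k : ℕ} {t : ℝ} (ht0 : 0 < t)
    (f : Lp ℂ 2 (heatMeasure k 1)) (r : ℝ) (u v : Fin k → ℝ) :
    ‖segalBargmann k 1 t f ((r : ℂ) • fun j => (u j : ℂ) + (v j : ℂ) * Complex.I)‖ₑ ^ 2 =
      ENNReal.ofReal (((2 * Real.pi * t) ^ (-((k : ℝ) / 2))) ^ 2 *
        Real.exp (r ^ 2 * (∑ j, v j ^ 2) / t)) *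
      ‖∫ y : Fin k → ℝ, Complex.exp ((r / t * ∑ j, y j * v j : ℝ) * Complex.I) *
        segalBargmannIntegrand k t f (fun j => ((r * u j : ℝ) : ℂ)) y‖ₑ ^ 2 := by
  have hpi := Real.pi_pos
  simp only [segalBargmann, segalBargmannIntegrand_add_mul_I ht0.ne']
  rw [integral_const_mul, ← mul_assoc, enorm_mul, mul_pow]
  congr 1
  rw [← ofReal_norm, ← ENNReal.ofReal_pow (norm_nonneg _), norm_mul, Complex.norm_exp,
    Complex.norm_real, mul_pow, Real.norm_eq_abs, sq_abs, ← Real.exp_nat_mul]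
  rw [Complex.add_re, Complex.ofReal_re, Complex.re_ofReal_mul, Complex.I_re]
  congr 3
  push_cast
  field_simp
  ring

/-- The density of `γ_T` with respect to Lebesgue measure. -/
noncomputable def gammaDensity (k : ℕ) (T : ℝ) (a : Fin k → ℂ) : ℝ :=
  (Real.pi * (Real.exp T + 1)) ^ (-((k : ℝ) / 2)) *
    (Real.pi * (Real.exp T - 1)) ^ (-((k : ℝ) / 2)) *
    Real.exp (-(∑ j, (a j).re ^ 2) / (Real.exp T + 1)) *
    Real.exp (-(∑ j, (a j).im ^ 2) / (Real.exp T - 1))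

theorem gammaMeasure_eq (k : ℕ) (T : ℝ) :
    gammaMeasure k T = volume.withDensity fun a => ENNReal.ofReal (gammaDensity k T a) := rfl

theorem continuous_gammaDensity (k : ℕ) (T : ℝ) : Continuous (gammaDensity k T) := by
  unfold gammaDensity; fun_prop

theorem gammaDensity_pos (k : ℕ) {T : ℝ} (hT : 0 < T) (a : Fin k → ℂ) : 0 < gammaDensity k T a := by
  have := Real.pi_pos
  have h1 : 0 < Real.exp T - 1 := by linarith [Real.add_one_lt_exp hT.ne']
  unfold gammaDensity
  positivity

theorem one_sub_exp_neg_pos {T : ℝ} (hT : 0 < T) : 0 < 1 - Real.exp (-T) := by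
  have : Real.exp (-T) < 1 := by rw [← Real.exp_zero]; exact Real.exp_lt_exp.2 (by linarith)
  linarith

theorem one_sub_exp_neg_lt_one (T : ℝ) : 1 - Real.exp (-T) < 1 := by
  linarith [Real.exp_pos (-T)]

theorem eulerDilation_neg_half (k : ℕ) (T : ℝ) (F : (Fin k → ℂ) → ℂ) (a : Fin k → ℂ) :
    eulerDilation k (-((T : ℂ) / 2)) F a = F ((Real.exp (-(T / 2)) : ℂ) • a) := by
  rw [eulerDilation]
  push_cast
  rfl

theorem exp_neg_half_sq_mul_exp (T : ℝ) : Real.exp (-(T / 2)) ^ 2 * Real.exp T = 1 := by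
  rw [← Real.exp_nat_mul, ← Real.exp_add, Real.exp_eq_one_iff]
  push_cast
  ring

theorem one_sub_exp_neg_mul_exp (T : ℝ) : (1 - Real.exp (-T)) * Real.exp T = Real.exp T - 1 := by
  rw [sub_mul, ← Real.exp_add]
  simp

/-- Once the Gaussian of `γ_T` in `v` has cancelled the growth of the transform, only the squared
modulus of a Fourier integral in `v` is left, and Plancherel evaluates it. -/
theorem lintegral_gammaDensity_mul_enorm_segalBargmann {k : ℕ} {T : ℝ} (hT : 0 < T)
    (f : Lp ℂ 2 (heatMeasure k 1)) (u : Fin k → ℝ) :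
    ∫⁻ v : Fin k → ℝ,
      ENNReal.ofReal (gammaDensity k T fun j => (u j : ℂ) + (v j : ℂ) * Complex.I) *
      ‖segalBargmann k 1 (1 - Real.exp (-T)) f ((Real.exp (-(T / 2)) : ℂ) •
        fun j => (u j : ℂ) + (v j : ℂ) * Complex.I)‖ₑ ^ 2 =
    ∫⁻ y : Fin k → ℝ, ENNReal.ofReal ((Real.pi * (Real.exp T + 1)) ^ (-((k : ℝ) / 2)) *
      (Real.pi * (Real.exp T - 1)) ^ (-((k : ℝ) / 2)) *
      ((2 * Real.pi * (1 - Real.exp (-T))) ^ (-((k : ℝ) / 2))) ^ 2 *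
      (2 * Real.pi / (Real.exp (-(T / 2)) / (1 - Real.exp (-T)))) ^ k *
      (Real.exp (-(∑ j, u j ^ 2) / (Real.exp T + 1)) *
        Real.exp (-(∑ j, (Real.exp (-(T / 2)) * u j - y j) ^ 2) / (1 - Real.exp (-T))))) *
      ‖f y‖ₑ ^ 2 := by
  have ht0 := one_sub_exp_neg_pos hT
  have ht1 := one_sub_exp_neg_lt_one T
  have hr0 := Real.exp_pos (-(T / 2))
  have hrx := exp_neg_half_sq_mul_exp T
  have htx := one_sub_exp_neg_mul_exp T
  have hx : 1 < Real.exp T := Real.one_lt_exp_iff.2 hT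
  unfold gammaDensity
  simp only [enorm_segalBargmann_add_mul_I_sq ht0]
  set t := 1 - Real.exp (-T) with ht
  set r := Real.exp (-(T / 2)) with hr
  set x := Real.exp T with hxd
  have hpi := Real.pi_pos
  have hx1 : 0 < x - 1 := by linarith
  -- The growth rate of the transform in `v` equals the decay rate of `γ_T` in `v`; the dilation by
  -- `r` is chosen for this.
  have hβ : r ^ 2 / t = 1 / (x - 1) := by
    have : t = (x - 1) / x := by field_simp; linarith
    have h2 : r ^ 2 = 1 / x := by field_simp; linarith
    rw [this, h2]; field_simp
  set A := (Real.pi * (x + 1)) ^ (-((k : ℝ) / 2)) * (Real.pi * (x - 1)) ^ (-((k : ℝ) / 2)) with hA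
  set N := (2 * Real.pi * t) ^ (-((k : ℝ) / 2)) with hN
  have hA0 : 0 ≤ A := by positivity
  have hstep : ∀ v : Fin k → ℝ,
      ENNReal.ofReal (A * Real.exp (-(∑ j, ((u j : ℂ) + (v j : ℂ) * Complex.I).re ^ 2) / (x + 1)) *
        Real.exp (-(∑ j, ((u j : ℂ) + (v j : ℂ) * Complex.I).im ^ 2) / (x - 1))) *
      (ENNReal.ofReal (N ^ 2 * Real.exp (r ^ 2 * (∑ j, v j ^ 2) / t)) *
      ‖∫ y : Fin k → ℝ, Complex.exp ((r / t * ∑ j, y j * v j : ℝ) * Complex.I) *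
        segalBargmannIntegrand k t f (fun j => ((r * u j : ℝ) : ℂ)) y‖ₑ ^ 2) =
      ENNReal.ofReal (A * N ^ 2 * Real.exp (-(∑ j, u j ^ 2) / (x + 1))) *
      ‖∫ y : Fin k → ℝ, Complex.exp ((r / t * ∑ j, y j * v j : ℝ) * Complex.I) *
        segalBargmannIntegrand k t f (fun j => ((r * u j : ℝ) : ℂ)) y‖ₑ ^ 2 := fun v => by
    rw [← mul_assoc, ← ENNReal.ofReal_mul (by positivity)]
    congr 2
    have e : Real.exp (-(∑ j, v j ^ 2) / (x - 1)) * Real.exp (r ^ 2 * (∑ j, v j ^ 2) / t) = 1 := by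
      rw [← Real.exp_add, mul_div_right_comm, hβ, Real.exp_eq_one_iff]
      ring
    simp only [Complex.add_re, Complex.ofReal_re, Complex.re_ofReal_mul, Complex.I_re, mul_zero,
      add_zero, Complex.add_im, Complex.ofReal_im, Complex.im_ofReal_mul, Complex.I_im, mul_one,
      zero_add]
    linear_combination (A * N ^ 2 * Real.exp (-(∑ j, u j ^ 2) / (x + 1))) * e
  simp only [hstep]
  rw [lintegral_const_mul' _ _ ENNReal.ofReal_ne_top,
    lintegral_enorm_fourier_scaled_sq (integrable_segalBargmannIntegrand ht0 ht1 f _)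
      (memLp_segalBargmannIntegrand ht0 ht1 f _) (div_pos hr0 ht0).ne', ← mul_assoc,
    ← ENNReal.ofReal_mul (by positivity), ← lintegral_const_mul' _ _ ENNReal.ofReal_ne_top]
  refine lintegral_congr fun y => ?_
  have hg : ‖segalBargmannIntegrand k t f (fun j => ((r * u j : ℝ) : ℂ)) y‖ₑ ^ 2 =
      ENNReal.ofReal (Real.exp (-(∑ j, (r * u j - y j) ^ 2) / t)) * ‖f y‖ₑ ^ 2 := by
    rw [segalBargmannIntegrand, enorm_mul, mul_pow, mul_comm]
    congr 1
    rw [← ofReal_norm, ← ENNReal.ofReal_pow (norm_nonneg _), Complex.norm_exp, re_heatExponent,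
      ← Real.exp_nat_mul]
    congr 2
    simp only [Complex.ofReal_re, Complex.ofReal_im, ← Finset.sum_neg_distrib, Finset.sum_div,
      Finset.mul_sum]
    refine Finset.sum_congr rfl fun j _ => ?_
    push_cast
    field_simp
    ring
  rw [hg, ← mul_assoc, ← ENNReal.ofReal_mul (by positivity), abs_of_pos (div_pos hr0 ht0)]
  congr 2
  ring

theorem lintegral_enorm_segalBargmann_sq {k : ℕ} {T : ℝ} (hT : 0 < T)
    (f : Lp ℂ 2 (heatMeasure k 1)) :
    ∫⁻ a, ‖eulerDilation k (-((T : ℂ) / 2))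
      (segalBargmann k 1 (1 - Real.exp (-T)) f) a‖ₑ ^ 2 ∂(gammaMeasure k T) =
    ∫⁻ y, ‖f y‖ₑ ^ 2 ∂(heatMeasure k 1) := by
  have ht0 := one_sub_exp_neg_pos hT
  have ht1 := one_sub_exp_neg_lt_one T
  have hx : 1 < Real.exp T := Real.one_lt_exp_iff.2 hT
  have hcont := (differentiable_segalBargmann ht0 ht1 f).continuous
  have hfm : Measurable fun y => ‖f y‖ₑ ^ 2 := (Lp.stronglyMeasurable f).measurable.enorm.pow_const 2
  simp only [eulerDilation_neg_half]
  have hm1 : Measurable fun a => ENNReal.ofReal (gammaDensity k T a) :=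
    (continuous_gammaDensity k T).measurable.ennreal_ofReal
  have hm2 : Measurable fun a : Fin k → ℂ => ‖segalBargmann k 1 (1 - Real.exp (-T)) f
      ((Real.exp (-(T / 2)) : ℂ) • a)‖ₑ ^ 2 :=
    (hcont.comp (continuous_const_smul _)).measurable.enorm.pow_const 2
  rw [gammaMeasure_eq, lintegral_withDensity_eq_lintegral_mul _ hm1 hm2,
    lintegral_pi_complex (hm1.mul hm2)]
  simp only [Pi.mul_apply, lintegral_gammaDensity_mul_enorm_segalBargmann hT]
  rw [lintegral_lintegral_swap]
  · refine Eq.trans ?_ (lintegral_withDensity_eq_lintegral_mul volume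
      (measurable_ofReal_heatDensity k 1) hfm).symm
    refine lintegral_congr fun y => ?_
    rw [lintegral_mul_const'' _ (Continuous.measurable (by fun_prop)).ennreal_ofReal.aemeasurable,
      lintegral_gamma_kernel k hx (Real.exp_pos _) (exp_neg_half_sq_mul_exp T)
        (one_sub_exp_neg_mul_exp T) y, Pi.mul_apply]
  · refine Measurable.aemeasurable (Measurable.mul ?_ (hfm.comp measurable_snd))
    exact (Continuous.measurable (by fun_prop)).ennreal_ofReal

theorem eLpNorm_segalBargmann {k : ℕ} {T : ℝ} (hT : 0 < T) (f : Lp ℂ 2 (heatMeasure k 1)) :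
    eLpNorm (eulerDilation k (-((T : ℂ) / 2)) (segalBargmann k 1 (1 - Real.exp (-T)) f)) 2
      (gammaMeasure k T) = eLpNorm f 2 (heatMeasure k 1) := by
  have h := lintegral_enorm_segalBargmann_sq hT f
  rw [← eLpNorm_two_sq, ← eLpNorm_two_sq] at h
  exact (ENNReal.pow_right_strictMono two_ne_zero).injective h

theorem differentiable_eulerDilation {k : ℕ} (l : ℂ) {F : (Fin k → ℂ) → ℂ}
    (hF : Differentiable ℂ F) : Differentiable ℂ (eulerDilation k l F) :=
  hF.comp (g := F) (f := fun a => Complex.exp l • a) (by fun_prop)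

theorem eulerDilation_segalBargmann_mem {k : ℕ} {T : ℝ} (hT : 0 < T)
    (f : Lp ℂ 2 (heatMeasure k 1)) :
    eulerDilation k (-((T : ℂ) / 2)) (segalBargmann k 1 (1 - Real.exp (-T)) f) ∈
      holoL2Submodule (gammaMeasure k T) := by
  have hd := differentiable_eulerDilation (-((T : ℂ) / 2))
    (differentiable_segalBargmann (one_sub_exp_neg_pos hT) (one_sub_exp_neg_lt_one T) f)
  refine ⟨hd, hd.continuous.aestronglyMeasurable, ?_⟩
  rw [eLpNorm_segalBargmann hT]
  exact (Lp.memLp f).2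

/-- Allows the transform of a sum, a multiple or an explicit Gaussian to be computed from a
convenient representative. -/
theorem segalBargmann_eq_of_ae {k : ℕ} (t : ℝ) {f : Lp ℂ 2 (heatMeasure k 1)}
    {g : (Fin k → ℝ) → ℂ} (h : f =ᵐ[heatMeasure k 1] g) (z : Fin k → ℂ) :
    segalBargmann k 1 t f z = (((2 * Real.pi * t) ^ (-((k : ℝ) / 2)) : ℝ) : ℂ) *
      ∫ y, segalBargmannIntegrand k t g z y := by
  rw [segalBargmann]
  congr 1
  refine integral_congr_ae ?_
  filter_upwards [(volume_absolutelyContinuous_heatMeasure k one_pos).ae_eq h] with y hy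
  rw [segalBargmannIntegrand, segalBargmannIntegrand, hy]

theorem segalBargmann_add {k : ℕ} {t : ℝ} (ht0 : 0 < t) (ht1 : t < 1)
    (f g : Lp ℂ 2 (heatMeasure k 1)) :
    segalBargmann k 1 t (f + g) = segalBargmann k 1 t f + segalBargmann k 1 t g := by
  ext z
  rw [segalBargmann_eq_of_ae t (Lp.coeFn_add f g), Pi.add_apply, segalBargmann, segalBargmann,
    ← mul_add, ← integral_add (integrable_segalBargmannIntegrand ht0 ht1 f z)
      (integrable_segalBargmannIntegrand ht0 ht1 g z)]
  simp only [segalBargmannIntegrand, Pi.add_apply, add_mul]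

theorem segalBargmann_smul {k : ℕ} (t : ℝ) (c : ℂ) (f : Lp ℂ 2 (heatMeasure k 1)) :
    segalBargmann k 1 t (c • f) = c • segalBargmann k 1 t f := by
  ext z
  rw [segalBargmann_eq_of_ae t (Lp.coeFn_smul c f), Pi.smul_apply, segalBargmann, smul_eq_mul,
    mul_left_comm, ← integral_const_mul c]
  simp only [segalBargmannIntegrand, Pi.smul_apply, smul_eq_mul, mul_assoc]

/-- The dilated Segal-Bargmann transform as an isometry into `HL²(ℂ^k, γ_T)`. -/
noncomputable def segalBargmannIsometry (k : ℕ) {T : ℝ} (hT : 0 < T) :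
    Lp ℂ 2 (heatMeasure k 1) →ₗᵢ[ℂ] HoloL2 (gammaMeasure k T) where
  toFun f := ⟨eulerDilation k (-((T : ℂ) / 2)) (segalBargmann k 1 (1 - Real.exp (-T)) f),
    eulerDilation_segalBargmann_mem hT f⟩
  map_add' f g := Subtype.ext <| by
    simp only [segalBargmann_add (one_sub_exp_neg_pos hT) (one_sub_exp_neg_lt_one T)]
    rfl
  map_smul' c f := Subtype.ext <| by
    simp only [segalBargmann_smul]
    rfl
  norm_map' f := by
    change ‖MemLp.toLp _ (eulerDilation_segalBargmann_mem hT f).2‖ = ‖f‖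
    rw [Lp.norm_toLp, eLpNorm_segalBargmann hT, Lp.norm_def]

/-! ### Coherent states in the range -/

theorem memLp_gaussian_exp {k : ℕ} {δ : ℝ} (hδ : 0 < δ) (l : Fin k → ℂ) :
    MemLp (fun y : Fin k → ℝ => Complex.exp (-(δ : ℂ) * ∑ j, (y j : ℂ) ^ 2 + ∑ j, l j * (y j : ℂ)))
      2 (heatMeasure k 1) := by
  have hpi := Real.pi_pos
  have hc : Continuous fun y : Fin k → ℝ =>
      Complex.exp (-(δ : ℂ) * ∑ j, (y j : ℂ) ^ 2 + ∑ j, l j * (y j : ℂ)) := by fun_prop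
  rw [memLp_two_iff_integrable_sq_norm hc.aestronglyMeasurable]
  refine (integrable_withDensity_iff_integrable_smul' (measurable_ofReal_heatDensity k 1)
    (by simp)).2 ?_
  refine ((integrable_exp_neg_sum_sq k (c := 2 * δ) (by positivity)
    (fun j => 2 * (l j).re)).const_mul ((2 * Real.pi * 1) ^ (-((k : ℝ) / 2)))).mono' ?_ ?_
  · exact ((measurable_ofReal_heatDensity k 1).ennreal_toReal.aestronglyMeasurable).smul
      (hc.norm.pow 2).aestronglyMeasurable
  · refine Filter.Eventually.of_forall fun y => ?_
    rw [ENNReal.toReal_ofReal (heatDensity_pos k one_pos y).le, smul_eq_mul, norm_mul,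
      Real.norm_of_nonneg (heatDensity_pos k one_pos y).le, norm_pow, norm_norm, Complex.norm_exp,
      ← Real.exp_nat_mul, heatDensity]
    have h1 : Real.exp (-(∑ j, y j ^ 2) / (2 * 1)) ≤ 1 := by
      rw [Real.exp_le_one_iff]
      have : 0 ≤ ∑ j, y j ^ 2 := Finset.sum_nonneg fun j _ => sq_nonneg _
      linarith
    have h2 : ((2 : ℕ) : ℝ) * (-(δ : ℂ) * ∑ j, (y j : ℂ) ^ 2 + ∑ j, l j * (y j : ℂ)).re =
        -(2 * δ) * ∑ j, y j ^ 2 + ∑ j, 2 * (l j).re * y j := by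
      have : (-(δ : ℂ) * ∑ j, (y j : ℂ) ^ 2) = ((-δ * ∑ j, y j ^ 2 : ℝ) : ℂ) := by push_cast; rfl
      rw [Complex.add_re, this, Complex.ofReal_re, Complex.re_sum, mul_add, Finset.mul_sum (s := .univ)
        (f := fun j => (l j * (y j : ℂ)).re)]
      congr 1
      · push_cast
        ring
      · refine Finset.sum_congr rfl fun j _ => ?_
        rw [Complex.re_mul_ofReal]
        push_cast
        ring
    rw [h2]
    exact mul_le_mul_of_nonneg_right (mul_le_of_le_one_right (by positivity) h1)
      (Real.exp_nonneg _)

/-- As `1/t = x/(x - 1)`, the coefficients `1/(2(x - 1))` of the Gaussian and `1/(2t)` of the kernel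
add up to `(x + 1)/(2(x - 1))`. -/
theorem segalBargmann_gaussian_exponent {k : ℕ} {x t : ℝ} (hx : 1 < x) (htx : t * x = x - 1)
    (l z : Fin k → ℂ) (y : Fin k → ℝ) :
    (-((1 / (2 * (x - 1)) : ℝ) : ℂ) * ∑ j, (y j : ℂ) ^ 2 + ∑ j, l j * (y j : ℂ)) +
      -(∑ j, (z j - (y j : ℂ)) ^ 2) / (2 * (t : ℂ)) =
    -(∑ j, z j ^ 2) / (2 * (t : ℂ)) +
      (-(((x + 1) / (2 * (x - 1)) : ℝ) : ℂ) * ∑ j, (y j : ℂ) ^ 2 +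
        ∑ j, (z j / t + l j) * (y j : ℂ)) := by
  have hx0 : (x : ℂ) ≠ 0 := by exact_mod_cast (by linarith : x ≠ 0)
  have hx1 : (x : ℂ) - 1 ≠ 0 := by exact_mod_cast (by linarith : x - 1 ≠ 0)
  have ht : (t : ℂ) = (x - 1) / x := by
    field_simp; exact_mod_cast htx
  simp only [Finset.mul_sum, ← Finset.sum_neg_distrib, Finset.sum_div, ← Finset.sum_add_distrib]
  refine Finset.sum_congr rfl fun j _ => ?_
  rw [ht]
  push_cast
  field_simp
  ring

theorem segalBargmann_gaussian_completed_exponent {k : ℕ} {x r t : ℝ} (hx : 1 < x) (hr0 : 0 < r)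
    (hrx : r ^ 2 * x = 1) (htx : t * x = x - 1) (w a : Fin k → ℂ) :
    -(∑ j, ((r : ℂ) • a) j ^ 2) / (2 * (t : ℂ)) +
      (∑ j, (((r : ℂ) • a) j / t + conj (w j) / (r * (x - 1))) ^ 2) /
        (4 * (((x + 1) / (2 * (x - 1)) : ℝ) : ℂ)) =
    (∑ j, (conj (w j) / (r * (x - 1))) ^ 2) / (4 * (((x + 1) / (2 * (x - 1)) : ℝ) : ℂ)) +
      ((-(∑ j, a j ^ 2) / (2 * ((x : ℂ) ^ 2 - 1))) +
        (x : ℂ) / ((x : ℂ) ^ 2 - 1) * ∑ j, a j * conj (w j)) := by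
  have hx0 : (x : ℂ) ≠ 0 := by exact_mod_cast (by linarith : x ≠ 0)
  have hx1 : (x : ℂ) - 1 ≠ 0 := by exact_mod_cast (by linarith : x - 1 ≠ 0)
  have hx2 : (x : ℂ) + 1 ≠ 0 := by exact_mod_cast (by linarith : x + 1 ≠ 0)
  have hr : (r : ℂ) ≠ 0 := by exact_mod_cast hr0.ne'
  have ht : (t : ℂ) = (x - 1) / x := by
    field_simp; exact_mod_cast htx
  have hrx' : (r : ℂ) ^ 2 * x = 1 := by exact_mod_cast hrx
  rw [show (x : ℂ) ^ 2 - 1 = (x - 1) * (x + 1) by ring]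
  simp only [Finset.mul_sum, ← Finset.sum_neg_distrib, Finset.sum_div, ← Finset.sum_add_distrib,
    Pi.smul_apply, smul_eq_mul]
  refine Finset.sum_congr rfl fun j _ => ?_
  rw [ht]
  push_cast
  generalize conj (w j) = c
  have e : ∀ d : ℂ, (r * a j / ((x - 1) / x) + d) ^ 2 =
      (r ^ 2 * x) * (x * a j ^ 2 / (x - 1) ^ 2) + 2 * (r * d) * (a j * x / (x - 1)) + d ^ 2 := by
    intro d; field_simp; ring
  rw [e, hrx', show (r : ℂ) * (c / (r * (x - 1))) = c / (x - 1) by field_simp, mul_pow,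
    show -((r : ℂ) ^ 2 * a j ^ 2) / (2 * ((x - 1) / x)) = -((r ^ 2 * x) * a j ^ 2) / (2 * (x - 1)) by
      field_simp, hrx']
  generalize (c / (r * (x - 1)) : ℂ) = d
  field_simp
  ring

/-- The range of the dilated transform contains the (Gaussian weighted) coherent states. -/
theorem exists_segalBargmann_eq_coherent {k : ℕ} {T : ℝ} (hT : 0 < T) (w : Fin k → ℂ) :
    ∃ f : Lp ℂ 2 (heatMeasure k 1), ∃ c : ℂ, c ≠ 0 ∧ ∀ a,
      eulerDilation k (-((T : ℂ) / 2)) (segalBargmann k 1 (1 - Real.exp (-T)) f) a =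
        c * Complex.exp (-(∑ j, a j ^ 2) / (2 * ((Real.exp T : ℂ) ^ 2 - 1)) +
          (Real.exp T : ℂ) / ((Real.exp T : ℂ) ^ 2 - 1) * ∑ j, a j * conj (w j)) := by
  have hpi := Real.pi_pos
  have hx : 1 < Real.exp T := Real.one_lt_exp_iff.2 hT
  have hx1 : 0 < Real.exp T - 1 := by linarith
  have ht0 := one_sub_exp_neg_pos hT
  have htx := one_sub_exp_neg_mul_exp T
  have hrx := exp_neg_half_sq_mul_exp T
  have hr0 := Real.exp_pos (-(T / 2))
  simp only [eulerDilation_neg_half]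
  generalize Real.exp (-(T / 2)) = r at *
  generalize 1 - Real.exp (-T) = t at *
  generalize Real.exp T = x at *
  have hD : 0 < (x + 1) / (2 * (x - 1)) := by positivity
  -- The linear coefficient makes the cross term of the completed square equal to `x/(x² - 1) a·conj
  -- w`. The quadratic coefficient `1/(2(x - 1))` below produces `-a²/(2(x² - 1))`, whose conjugate
  -- cancels the `conj(a)²` part of the exponent of `γ_T`.
  set l : Fin k → ℂ := fun j => conj (w j) / (r * (x - 1)) with hl
  have hmem := memLp_gaussian_exp (δ := 1 / (2 * (x - 1))) (by positivity) l
  refine ⟨hmem.toLp, (((2 * Real.pi * t) ^ (-((k : ℝ) / 2)) : ℝ) : ℂ) *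
    (((Real.pi : ℂ) / (((x + 1) / (2 * (x - 1)) : ℝ) : ℂ)) ^ ((k : ℂ) / 2) *
    Complex.exp ((∑ j, l j ^ 2) / (4 * (((x + 1) / (2 * (x - 1)) : ℝ) : ℂ)))), ?_, fun a => ?_⟩
  · refine mul_ne_zero ?_ (mul_ne_zero ?_ (Complex.exp_ne_zero _))
    · exact_mod_cast (by positivity : (2 * Real.pi * t) ^ (-((k : ℝ) / 2)) ≠ 0)
    · rw [Complex.cpow_def_of_ne_zero]
      · exact Complex.exp_ne_zero _
      · exact div_ne_zero (by exact_mod_cast hpi.ne') (by exact_mod_cast hD.ne')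
  · rw [segalBargmann_eq_of_ae t hmem.coeFn_toLp]
    simp only [segalBargmannIntegrand, ← Complex.exp_add, segalBargmann_gaussian_exponent hx htx]
    simp only [Complex.exp_add (-(∑ j, ((r : ℂ) • a) j ^ 2) / (2 * (t : ℂ)))]
    rw [integral_const_mul, GaussianFourier.integral_cexp_neg_mul_sum_add
      (by rw [Complex.ofReal_re]; exact hD), Fintype.card_fin, mul_left_comm (Complex.exp _) (_ ^ _),
      ← Complex.exp_add,
      segalBargmann_gaussian_completed_exponent hx hr0 hrx htx, Complex.exp_add]
    ring

/-! ### Pairing with coherent states, and surjectivity -/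

theorem integrable_cexp_neg_sum_norm_sq (k : ℕ) {p : ℝ} (hp : 0 < p) :
    Integrable fun b : Fin k → ℂ => Complex.exp ((-(p * ∑ j, ‖b j‖ ^ 2) : ℝ) : ℂ) := by
  have h1 : Integrable fun z : ℂ => Complex.exp (-(p : ℂ) * (‖z‖ : ℂ) ^ 2) := by
    simpa using GaussianFourier.integrable_cexp_neg_mul_sq_norm_add (V := ℂ) (b := (p : ℂ))
      (by simpa) 0 0
  refine (Integrable.fintype_prod (ι := Fin k) (f := fun _ z =>
    Complex.exp (-(p : ℂ) * (‖z‖ : ℂ) ^ 2)) fun _ => h1).congr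
    (Filter.Eventually.of_forall fun b => ?_)
  simp only [← Complex.exp_sum]
  congr 1
  push_cast
  rw [Finset.mul_sum, ← Finset.sum_neg_distrib]
  simp

theorem integral_cexp_neg_sum_norm_sq_ne_zero (k : ℕ) {p : ℝ} (hp : 0 < p) :
    ∫ b : Fin k → ℂ, Complex.exp ((-(p * ∑ j, ‖b j‖ ^ 2) : ℝ) : ℂ) ≠ 0 := by
  have h := (integrable_cexp_neg_sum_norm_sq k hp).re
  simp only [← Complex.ofReal_exp, RCLike.re_to_complex, Complex.ofReal_re] at h
  simp only [← Complex.ofReal_exp]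
  rw [integral_complex_ofReal]
  exact_mod_cast (integral_exp_pos h).ne'

/-- The exponents in the pairing with a coherent state, centred at `w`. -/
theorem coherent_exponent {k : ℕ} {x : ℝ} (hx : 1 < x) (w b : Fin k → ℂ) :
    ((-(∑ j, (w j + b j).re ^ 2) / (x + 1) + -(∑ j, (w j + b j).im ^ 2) / (x - 1) : ℝ) : ℂ) +
      conj (-(∑ j, (w j + b j) ^ 2) / (2 * ((x : ℂ) ^ 2 - 1)) +
        (x : ℂ) / ((x : ℂ) ^ 2 - 1) * ∑ j, (w j + b j) * conj (w j)) =
    ((∑ j, (w j + b j) ^ 2) / (2 * ((x : ℂ) ^ 2 - 1)) -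
      (x : ℂ) / ((x : ℂ) ^ 2 - 1) * ∑ j, conj (w j) * b j) +
      ((-(x / (x ^ 2 - 1) * ∑ j, ‖b j‖ ^ 2) : ℝ) : ℂ) := by
  have hx1 : (x : ℂ) - 1 ≠ 0 := by exact_mod_cast (by linarith : x - 1 ≠ 0)
  have hx2 : (x : ℂ) + 1 ≠ 0 := by exact_mod_cast (by linarith : x + 1 ≠ 0)
  push_cast
  simp only [map_add, map_neg, map_mul, map_div₀, map_sum, map_pow, map_sub, map_one,
    Complex.conj_ofReal, Complex.conj_conj, map_ofNat]
  rw [show (x : ℂ) ^ 2 - 1 = (x - 1) * (x + 1) by ring]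
  simp only [Finset.mul_sum, ← Finset.sum_neg_distrib, Finset.sum_div, ← Finset.sum_add_distrib,
    ← Finset.sum_sub_distrib]
  refine Finset.sum_congr rfl fun j _ => ?_
  have h1 : ((‖b j‖ : ℝ) : ℂ) ^ 2 = b j * conj (b j) := by
    rw [Complex.mul_conj, Complex.normSq_eq_norm_sq]; push_cast; rfl
  have h2 : (((w j + b j).re : ℝ) : ℂ) = (w j + b j + (conj (w j) + conj (b j))) / 2 := by
    rw [Complex.re_eq_add_conj, map_add]
  have h3 : (((w j + b j).im : ℝ) : ℂ) ^ 2 = -(w j + b j - (conj (w j) + conj (b j))) ^ 2 / 4 := by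
    rw [Complex.im_eq_sub_conj, map_add, div_pow, mul_pow, Complex.I_sq]; ring
  rw [h1, h2, h3]
  generalize conj (w j) = w'
  generalize conj (b j) = b'
  field_simp
  ring

/-- A holomorphic function orthogonal to the coherent states vanishes. -/
theorem eq_zero_of_inner_coherent_eq_zero {k : ℕ} {T : ℝ} (hT : 0 < T) {F K : (Fin k → ℂ) → ℂ}
    (hF : Differentiable ℂ F) (w : Fin k → ℂ) {c : ℂ} (hc : c ≠ 0)
    (hK : ∀ a, K a = c * Complex.exp (-(∑ j, a j ^ 2) / (2 * ((Real.exp T : ℂ) ^ 2 - 1)) +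
      (Real.exp T : ℂ) / ((Real.exp T : ℂ) ^ 2 - 1) * ∑ j, a j * conj (w j)))
    (hint : Integrable (fun a => conj (K a) * F a) (gammaMeasure k T))
    (h0 : ∫ a, conj (K a) * F a ∂(gammaMeasure k T) = 0) : F w = 0 := by
  have hpi := Real.pi_pos
  have hx : 1 < Real.exp T := Real.one_lt_exp_iff.2 hT
  have hm : Measurable fun a => ENNReal.ofReal (gammaDensity k T a) :=
    (continuous_gammaDensity k T).measurable.ennreal_ofReal
  rw [gammaMeasure_eq, integrable_withDensity_iff_integrable_smul' hm (by simp)] at hint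
  rw [gammaMeasure_eq, integral_withDensity_eq_integral_toReal_smul hm (by simp),
    ← integral_add_left_eq_self _ w] at h0
  have hint' := hint.comp_add_left w
  simp only [ENNReal.toReal_ofReal (gammaDensity_pos k hT _).le] at hint' h0
  unfold gammaDensity at hint' h0
  generalize Real.exp T = x at *
  have hx1 : 0 < x - 1 := by linarith
  have hx2 : 0 < x ^ 2 - 1 := by nlinarith
  have hx0 : 0 < x := by linarith
  set A := (Real.pi * (x + 1)) ^ (-((k : ℝ) / 2)) * (Real.pi * (x - 1)) ^ (-((k : ℝ) / 2)) with hA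
  have hA0 : (A : ℂ) * conj c ≠ 0 := mul_ne_zero
    (by exact_mod_cast (by positivity : A ≠ 0)) ((map_ne_zero _).2 hc)
  -- After the translation `a = w + b`, the density of `γ_T` times the conjugate coherent state
  -- depends on `conj b` only through `‖b‖²`. The rest is entire and joins `F` in `H`, leaving the
  -- radial weight `ρ`.
  set H : (Fin k → ℂ) → ℂ := fun b => F (w + b) *
    Complex.exp ((∑ j, (w j + b j) ^ 2) / (2 * ((x : ℂ) ^ 2 - 1)) -
      (x : ℂ) / ((x : ℂ) ^ 2 - 1) * ∑ j, conj (w j) * b j) with hHdef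
  set ρ : (Fin k → ℂ) → ℂ := fun b =>
    Complex.exp ((-(x / (x ^ 2 - 1) * ∑ j, ‖b j‖ ^ 2) : ℝ) : ℂ) with hρdef
  have hpt : ∀ b : Fin k → ℂ, (A * Real.exp (-(∑ j, ((w + b) j).re ^ 2) / (x + 1)) *
      Real.exp (-(∑ j, ((w + b) j).im ^ 2) / (x - 1))) • (conj (K (w + b)) * F (w + b)) =
      (A * conj c) * (H b * ρ b) := fun b => by
    have e := congrArg Complex.exp (coherent_exponent hx w b)
    rw [Complex.exp_add, Complex.exp_add _ (((-(x / (x ^ 2 - 1) * ∑ j, ‖b j‖ ^ 2) : ℝ) : ℂ)),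
      Complex.exp_conj, ← Complex.ofReal_exp, Real.exp_add] at e
    rw [hK, map_mul, Complex.real_smul]
    simp only [Pi.add_apply, hHdef, hρdef]
    push_cast at e ⊢
    linear_combination (A * conj c * F (w + b)) * e
  simp only [hpt] at h0
  have hint2 : Integrable fun b => H b * ρ b := by
    have h := hint'.const_mul ((A : ℂ) * conj c)⁻¹
    refine h.congr (Filter.Eventually.of_forall fun b => ?_)
    simp only [hpt, inv_mul_cancel_left₀ hA0]
  have hH : Differentiable ℂ H := by
    have : Differentiable ℂ fun b => F (w + b) := hF.comp (by fun_prop)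
    refine this.mul ?_
    fun_prop
  have hρ : Continuous ρ := by fun_prop
  rw [integral_const_mul, integral_entire_mul_weight hH hρ
    (fun c b => by simp only [hρdef, Pi.smul_apply, norm_smul, Circle.norm_coe, one_mul]) hint2] at h0
  have h3 := (mul_eq_zero.1 ((mul_eq_zero.1 h0).resolve_left hA0)).resolve_right
    (integral_cexp_neg_sum_norm_sq_ne_zero k (by positivity))
  -- `H 0` is `F w` times an exponential.
  simpa [hHdef, Complex.exp_ne_zero] using h3

theorem segalBargmannIsometry_surjective (k : ℕ) {T : ℝ} (hT : 0 < T) :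
    Function.Surjective (segalBargmannIsometry k hT) := by
  intro F
  let U := segalBargmannIsometry k hT
  -- The orthogonal projection is taken in the full `L²` space, so completeness of `HL²` is not
  -- needed: the range is closed because the domain is complete.
  let V : Lp ℂ 2 (heatMeasure k 1) →ₗᵢ[ℂ] Lp ℂ 2 (gammaMeasure k T) :=
    { toLinearMap := HoloL2.toL2 ∘ₗ U.toLinearMap
      norm_map' := fun f => U.norm_map f }
  let S : Submodule ℂ (Lp ℂ 2 (gammaMeasure k T)) := LinearMap.range V.toLinearMap
  have hS : IsClosed (S : Set (Lp ℂ 2 (gammaMeasure k T))) := by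
    have := V.isometry.isClosedEmbedding.isClosed_range
    convert this
    ext; simp [S]
  have : CompleteSpace S := hS.completeSpace_coe
  obtain ⟨y, ⟨f, hf⟩, z, hz, hyz⟩ := S.exists_add_mem_mem_orthogonal (HoloL2.toL2 F)
  refine ⟨f, ?_⟩
  -- The orthogonal component is the class of an entire function, so it can be evaluated at points.
  have hz' : z = HoloL2.toL2 (F - U f) := by
    rw [map_sub, hyz, ← hf]
    change z = V f + z - V f
    abel
  have horth : ∀ g, inner ℂ (U g) (F - U f) = 0 := fun g => by
    rw [← HoloL2.inner_toL2, ← hz']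
    exact (Submodule.mem_orthogonal S z).1 hz (V g) ⟨g, rfl⟩
  have hzero : F - U f = 0 := by
    refine Subtype.ext (funext fun w => ?_)
    obtain ⟨g, c, hc, hg⟩ := exists_segalBargmann_eq_coherent hT w
    exact eq_zero_of_inner_coherent_eq_zero hT (F - U f).2.1 w hc hg
      ((U g).2.2.star.integrable_mul (F - U f).2.2) (horth g)
  exact (sub_eq_zero.1 hzero).symm

theorem integral_norm_segalBargmann_sq {k : ℕ} {T : ℝ} (hT : 0 < T)
    (f : Lp ℂ 2 (heatMeasure k 1)) :
    ∫ x, ‖f x‖ ^ 2 ∂(heatMeasure k 1) =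
      ∫ a, ‖eulerDilation k (-((T : ℂ) / 2))
        (segalBargmann k 1 (1 - Real.exp (-T)) f) a‖ ^ 2 ∂(gammaMeasure k T) := by
  have hm := (eulerDilation_segalBargmann_mem hT f).2.1
  have key : ∀ {α : Type} [MeasurableSpace α] {m : Measure α} {g : α → ℂ},
      AEStronglyMeasurable g m → ∫ x, ‖g x‖ ^ 2 ∂m = (∫⁻ x, ‖g x‖ₑ ^ 2 ∂m).toReal := by
    intro α _ m g hg
    have hg2 : AEStronglyMeasurable (fun x => ‖g x‖ ^ 2) m := hg.norm.pow 2
    rw [integral_eq_lintegral_of_nonneg_ae (Filter.Eventually.of_forall fun _ => by positivity) hg2]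
    simp only [ENNReal.ofReal_pow (norm_nonneg _), ofReal_norm]
  rw [key (Lp.aestronglyMeasurable f), key hm, lintegral_enorm_segalBargmann_sq hT f]

theorem mainTheorem3 (k : ℕ) (hk : 1 ≤ k) (T : ℝ) (hT : 0 < T) :
    (∀ f : Lp ℂ 2 (heatMeasure k 1),
      (∀ z : Fin k → ℂ,
        Integrable (segalBargmannIntegrand k (1 - Real.exp (-T)) f z) volume) ∧
      Differentiable ℂ (segalBargmann k 1 (1 - Real.exp (-T)) f) ∧
      (∀ x : Fin k → ℝ,
        segalBargmann k 1 (1 - Real.exp (-T)) f (fun j => (x j : ℂ)) =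
          heatOperator k (1 - Real.exp (-T)) f x)) ∧
    (∃ U : Lp ℂ 2 (heatMeasure k 1) ≃ₗᵢ[ℂ] HoloL2 (gammaMeasure k T),
      ∀ f : Lp ℂ 2 (heatMeasure k 1),
        (U f : (Fin k → ℂ) → ℂ) =
          eulerDilation k (-((T : ℂ) / 2)) (segalBargmann k 1 (1 - Real.exp (-T)) f)) ∧
    (∀ f : Lp ℂ 2 (heatMeasure k 1),
      ∫ x, ‖f x‖ ^ 2 ∂(heatMeasure k 1) =
        ∫ a, ‖eulerDilation k (-((T : ℂ) / 2))
          (segalBargmann k 1 (1 - Real.exp (-T)) f) a‖ ^ 2 ∂(gammaMeasure k T)) := by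
  have ht0 := one_sub_exp_neg_pos hT
  have ht1 := one_sub_exp_neg_lt_one T
  refine ⟨fun f => ⟨integrable_segalBargmannIntegrand ht0 ht1 f,
    differentiable_segalBargmann ht0 ht1 f, segalBargmann_ofReal _ f⟩, ?_,
    integral_norm_segalBargmann_sq hT⟩
  -- Injectivity follows from the isometry because the domain is normed; a seminorm on the target is
  -- enough.
  exact ⟨LinearIsometryEquiv.ofSurjective (segalBargmannIsometry k hT)
    (segalBargmannIsometry_surjective k hT), fun f => rfl⟩
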